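/- Let $k\in\mathbb N$ and let $c\ge 1$ be a real number. There are constants $\alpha,\beta,K>0$ and $N\in\mathbb N$, depending only on $k$ and $c$, such that the following holds for every tree $T=(V,E)$ with $n\ge N$ vertices and maximum degree at most $k$. Let $L$ be a set of $n$ labels. The true labeling is a bijection $M_T:L\to V$, with an arbitrary initial value. At each of the times $c,2c,3c,\dots$ the random evolver picks an edge of $T$, uniformly at random and independently of everything else, and exchanges the labels at its two endpoints. A probe-and-move algorithm maintains a hypothesis $M_H:L\to V$ (not necessarily injective, with an arbitrary initial value). At each of the times $1,2,3,\dots$ (after the evolver's swap, if there is one at the same time) it performs one step: depending on all earlier probes and answers, on the current hypothesis and possibly on random bits independent of the evolver, it chooses a label $l$ and a vertex $u$; an oracle answers null if $M_T(l)=u$, and otherwise returns the first edge on the path in $T$ from $u$ to $M_T(l)$; depending also on this answer, the algorithm leaves $M_H(l)$ unchanged or changes it to a vertex adjacent to $M_H(l)$. Let $$D(\mathcal T,\mathcal H)_{(t)}=\sum_{l\in L} d_T\bigl(M_T(l),M_H(l)\bigr)$$ be the total tree distance between the two labelings at time $t$. Then for every such algorithm, all initial labelings, and every real time $t\ge Kn$,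 $$\Pr\bigl[D(\mathcal T,\mathcal H)_{(t)}\ge \alpha n\bigr]\ \ge\ 1-e^{-\beta n}.$$ -/

import Mathlib

open MeasureTheory ProbabilityTheory

namespace EvolvingTree

/-- Edge sets are finite discrete spaces. -/
instance edgeSetMeasurableSpace {V : Type*} (T : SimpleGraph V) : MeasurableSpace T.edgeSet := ⊤

/-- The transposition of the two endpoints of an unordered pair. -/
def swapEdge {V : Type*} [DecidableEq V] (e : Sym2 V) : Equiv.Perm V :=
  Sym2.lift ⟨fun u v => Equiv.swap u v, fun u v => Equiv.swap_comm u v⟩ e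

/-- The true labeling after `j` swaps of the evolver, which starts at `M₀` and in its swap number
`j + 1` exchanges the labels at the two endpoints of `ξ j`. -/
def trueLabeling {V L : Type*} [DecidableEq V] {T : SimpleGraph V}
    (M₀ : L ≃ V) (ξ : ℕ → T.edgeSet) : ℕ → (L ≃ V)
  | 0 => M₀
  | j + 1 => (trueLabeling M₀ ξ j).trans (swapEdge (ξ j : Sym2 V))

/-- The unique path between two vertices of a tree. -/
noncomputable def treePath {V : Type*} {T : SimpleGraph V} (hT : T.IsTree) (u v : V) :
    T.Walk u v :=
  (hT.existsUnique_path u v).choose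

/-- The oracle: for a label `l` and a vertex `u` it returns `none` if `l` is located at `u`, and
otherwise the first edge of the path from `u` to the location of `l`. -/
noncomputable def oracle {V L : Type*} [DecidableEq V] {T : SimpleGraph V} (hT : T.IsTree)
    (M : L ≃ V) (l : L) (u : V) : Option (Sym2 V) :=
  if M l = u then none else some s(u, (treePath hT u (M l)).snd)

/-- The record of one probe: the pair (label, vertex) and the answer of the oracle. -/
abbrev Probe (L V : Type*) := (L × V) × Option (Sym2 V)

/-- A probe-and-move algorithm on the tree `T`. It may use a random seed `s : S` (take `S` a
one-point space for deterministic algorithms). In each step it chooses, from the seed, the list of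
all earlier probes (most recent first) and the current hypothesis, a label and a vertex; it sees
the oracle's answer, and it then leaves the chosen label where it is in the hypothesis or moves it
to an adjacent vertex. -/
structure ProbeMoveAlgorithm {V : Type*} (T : SimpleGraph V) (L S : Type*)
    [MeasurableSpace S] where
  query : S → List (Probe L V) → (L → V) → L × V
  move : S → List (Probe L V) → (L → V) → (L × V) → Option (Sym2 V) → V
  move_adj : ∀ s h H q a, move s h H q a = H q.1 ∨ T.Adj (H q.1) (move s h H q a)
  measurable_query : ∀ h H q, MeasurableSet {s | query s h H = q}
  measurable_move : ∀ h H q a v, MeasurableSet {s | move s h H q a = v}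

/-- The list of probes (most recent first) and the hypothesized labeling after `m` steps of the
algorithm. Step number `m` takes place at time `m`. The evolver with speedup factor `c` performs
its swap number `j` at time `c * j`, so at time `m` it has performed `⌊m / c⌋₊` swaps. -/
noncomputable def run {V L S : Type*} [DecidableEq V] [DecidableEq L] [MeasurableSpace S]
    {T : SimpleGraph V} (hT : T.IsTree) (c : ℝ) (A : ProbeMoveAlgorithm T L S) (s : S)
    (M₀ : L ≃ V) (H₀ : L → V) (ξ : ℕ → T.edgeSet) : ℕ → List (Probe L V) × (L → V)
  | 0 => ([], H₀)
  | m + 1 =>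
    let h := (run hT c A s M₀ H₀ ξ m).1
    let H := (run hT c A s M₀ H₀ ξ m).2
    let q := A.query s h H
    let a := oracle hT (trueLabeling M₀ ξ ⌊((m + 1 : ℕ) : ℝ) / c⌋₊) q.1 q.2
    ((q, a) :: h, Function.update H q.1 (A.move s h H q a))

/-- The sum over all labels of the tree distance between the positions in two labelings. -/
noncomputable def labelingDist {V L : Type*} [Fintype L] (T : SimpleGraph V) (M H : L → V) : ℕ :=
  ∑ l, T.dist (M l) (H l)

/-- The distance between the true and the hypothesized labeling at the real time `t ≥ 0`. -/
noncomputable def distAt {V L S : Type*} [DecidableEq V] [DecidableEq L] [Fintype L]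
    [MeasurableSpace S] {T : SimpleGraph V} (hT : T.IsTree) (c : ℝ)
    (A : ProbeMoveAlgorithm T L S) (s : S) (M₀ : L ≃ V) (H₀ : L → V) (ξ : ℕ → T.edgeSet)
    (t : ℝ) : ℕ :=
  labelingDist T (trueLabeling M₀ ξ ⌊t / c⌋₊) (run hT c A s M₀ H₀ ξ ⌊t⌋₊).2

/-- The uniformly random evolver: the swapped edges are independent and uniformly distributed. -/
structure IsUniformEvolver {Ω V : Type*} [MeasurableSpace Ω] (P : Measure Ω) (T : SimpleGraph V)
    (ξ : ℕ → Ω → T.edgeSet) : Prop where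
  measurable : ∀ j, Measurable (ξ j)
  uniform : ∀ j e, P.real {ω | ξ j ω = e} = 1 / (Nat.card T.edgeSet : ℝ)
  indep : iIndepFun ξ P

end EvolvingTree

open EvolvingTree

namespace EvolvingTree

/-! ### Counting words by generating functions -/

section Words

variable {E : Type*} [Fintype E]

/-! The evolver creates more randomness than the algorithm can learn. Fix the seed and all swaps
except the last `3 * r` before time `t`, with `r` about `δ * n`. During these swaps the algorithm
makes only `O(r)` probes, each with at most `d + 1` possible answers, so it ends with one of at most
`exp (O(r))` hypotheses (`card_reachableStates_le`). Each hypothesis is close to few labelings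
(`card_ball_le`), and each labeling is produced by few words of `3 * r` swaps (`card_words_le`).
Multiplying the three counts bounds the bad words (`card_distAt_lt_le`). `measureReal_le_of_card_le`
averages over the seed and the early swaps.

The decisive factor is `(6 * d * r / N) ^ r` in `card_words_le`, where `N` is the number of edges:
it is of order `δ ^ r` and, for small `δ`, beats every factor `exp (O(r))` with a constant
independent of `δ`. It arises because, once the final labeling is prescribed, at least `r` letters
of the word are confined to `6 * d * r` edges each: an edge disjoint from all other swapped edges
can be read off from the final labeling, and any other letter meets another letter of the word. -/

theorem sum_ite_one_le (p : E → Prop) [DecidablePred p] {q z : ℝ} (hz : 0 ≤ z)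
    (h : ((Finset.univ.filter p).card : ℝ) ≤ q) :
    ∑ e, (if p e then z else 1) ≤ Fintype.card E + q * z := by
  calc ∑ e, (if p e then z else 1) ≤ ∑ e : E, (1 + if p e then z else 0) := by
        refine Finset.sum_le_sum fun e _ => ?_
        split_ifs <;> linarith
    _ = Fintype.card E + (Finset.univ.filter p).card * z := by
        rw [Finset.sum_add_distrib, ← Finset.sum_filter]
        simp
    _ ≤ _ := by gcongr

/-- Markov's inequality for the number of marked positions of a word. -/
theorem card_filter_mul_pow_le {m r : ℕ} {z : ℝ} (hz : 1 ≤ z)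
    (p : (Fin m → E) → Fin m → Prop) [∀ w, DecidablePred (p w)] :
    ((Finset.univ.filter fun w => r ≤ (Finset.univ.filter (p w)).card).card : ℝ) * z ^ r ≤
      ∑ w, ∏ i, (if p w i then z else 1) := by
  calc _ = ∑ w ∈ Finset.univ.filter fun w => r ≤ (Finset.univ.filter (p w)).card, z ^ r := by
        simp
    _ ≤ ∑ w ∈ Finset.univ.filter fun w => r ≤ (Finset.univ.filter (p w)).card,
          ∏ i, (if p w i then z else 1) := by
        refine Finset.sum_le_sum fun w hw => ?_
        rw [Finset.prod_ite]
        simpa using pow_le_pow_right₀ hz (Finset.mem_filter.1 hw).2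
    _ ≤ _ := by
        refine Finset.sum_le_sum_of_subset_of_nonneg (Finset.filter_subset _ _) fun w _ _ => ?_
        refine Finset.prod_nonneg fun i _ => ?_
        split_ifs <;> linarith

/-- The weight `z = N / q`, with `N` the number of letters, balances the two terms of `N + q * z`.
The loss is only `2 ^ m`, against a gain of `q / N` for each of `r` marked positions. -/
theorem card_filter_le_of_sum_le {m r : ℕ} {q : ℝ} (hq : 0 < q) (hqE : q ≤ Fintype.card E)
    (p : (Fin m → E) → Fin m → Prop) [∀ w, DecidablePred (p w)]
    (h : ∑ w, ∏ i, (if p w i then (Fintype.card E / q : ℝ) else 1) ≤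
      (Fintype.card E + q * (Fintype.card E / q)) ^ m) :
    ((Finset.univ.filter fun w => r ≤ (Finset.univ.filter (p w)).card).card : ℝ) ≤
      (2 * Fintype.card E) ^ m * (q / Fintype.card E) ^ r := by
  have hN : (0 : ℝ) < Fintype.card E := hq.trans_le hqE
  have h1 := (card_filter_mul_pow_le (r := r) ((one_le_div hq).2 hqE) p).trans h
  rw [mul_div_cancel₀ _ hq.ne', ← two_mul] at h1
  rw [← inv_div, inv_pow, ← div_eq_mul_inv, le_div_iff₀ (by positivity)]
  exact h1

/-- Positions of a word carrying a letter related to a later letter. -/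
theorem sum_prod_later_le (rel : E → E → Prop) [DecidableRel rel] {q z : ℝ} (hz : 0 ≤ z) {b : ℕ}
    (hb : ∀ f, (Finset.univ.filter fun e => rel e f).card ≤ b) (m : ℕ) (hq : (m * b : ℝ) ≤ q) :
    ∑ w : Fin m → E, ∏ i, (if ∃ j, i < j ∧ rel (w i) (w j) then z else 1) ≤
      (Fintype.card E + q * z) ^ m := by
  classical
  induction m with
  | zero => simp
  | succ m ih =>
    have hq' : (m * b : ℝ) ≤ q := by
      refine le_trans ?_ hq
      gcongr
      simp
    have hq0 : 0 ≤ q := le_trans (by positivity) hq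
    rw [← (Fin.consEquiv fun _ => E).sum_comp, Fintype.sum_prod_type_right]
    -- Whether a position is marked depends only on its own letter and the later ones. A new first
    -- letter therefore leaves all marks of the tail unchanged, and is itself marked for at most `m
    -- * b` values.
    have key : ∀ (w : Fin m → E), ∑ e : E, ∏ i : Fin (m + 1),
        (if ∃ j, i < j ∧ rel ((Fin.consEquiv fun _ => E) (e, w) i)
          ((Fin.consEquiv fun _ => E) (e, w) j) then z else 1) ≤
        (Fintype.card E + q * z) * ∏ i, (if ∃ j, i < j ∧ rel (w i) (w j) then z else 1) := by
      intro w
      have h1 : ∀ e : E, ∏ i : Fin (m + 1),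
          (if ∃ j, i < j ∧ rel ((Fin.consEquiv fun _ => E) (e, w) i)
            ((Fin.consEquiv fun _ => E) (e, w) j) then z else 1) =
          (if ∃ j, rel e (w j) then z else 1) *
            ∏ i, (if ∃ j, i < j ∧ rel (w i) (w j) then z else 1) := by
        intro e
        rw [Fin.prod_univ_succ]
        simp [Fin.consEquiv, Fin.exists_fin_succ]
      simp_rw [h1]
      rw [← Finset.sum_mul]
      refine mul_le_mul_of_nonneg_right (sum_ite_one_le _ hz ?_) ?_
      · refine le_trans ?_ hq'
        have : (Finset.univ.filter fun e => ∃ j, rel e (w j)) ⊆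
            Finset.univ.biUnion fun j => Finset.univ.filter fun e => rel e (w j) := by
          intro e
          simp
        have h2 := (Finset.card_le_card this).trans
          (Finset.card_biUnion_le_card_mul _ _ b fun j _ => hb (w j))
        simp only [Finset.card_univ, Fintype.card_fin] at h2
        exact_mod_cast h2
      · refine Finset.prod_nonneg fun i _ => ?_
        split_ifs <;> linarith
    refine (Finset.sum_le_sum fun w _ => key w).trans ?_
    rw [← Finset.mul_sum, pow_succ']
    exact mul_le_mul_of_nonneg_left (ih hq') (by positivity)

/-- Positions of a word carrying a letter related to an earlier letter. -/
theorem sum_prod_earlier_le (rel : E → E → Prop) [DecidableRel rel] {q z : ℝ} (hz : 0 ≤ z) {b : ℕ}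
    (hb : ∀ f, (Finset.univ.filter fun e => rel e f).card ≤ b) (m : ℕ) (hq : (m * b : ℝ) ≤ q) :
    ∑ w : Fin m → E, ∏ i, (if ∃ j, j < i ∧ rel (w i) (w j) then z else 1) ≤
      (Fintype.card E + q * z) ^ m := by
  refine le_of_eq_of_le ?_ (sum_prod_later_le rel hz hb m hq)
  -- Reversing the word exchanges earlier and later.
  rw [← (Equiv.arrowCongr (Fin.revPerm (n := m)) (Equiv.refl E)).sum_comp]
  refine Finset.sum_congr rfl fun w _ => ?_
  rw [← Equiv.prod_comp Fin.revPerm]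
  refine Finset.prod_congr rfl fun i _ => ?_
  congr 1
  rw [Fin.revPerm.surjective.exists]
  simp [Equiv.arrowCongr]

theorem sum_prod_mem_le (S : Finset E) [DecidableEq E] {q z : ℝ} (hz : 0 ≤ z)
    (hS : (S.card : ℝ) ≤ q) (m : ℕ) :
    ∑ w : Fin m → E, ∏ i, (if w i ∈ S then z else 1) ≤ (Fintype.card E + q * z) ^ m := by
  have h := Finset.prod_univ_sum (fun _ : Fin m => (Finset.univ : Finset E))
    (fun _ e => if e ∈ S then z else (1 : ℝ))
  rw [Fintype.piFinset_univ] at h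
  rw [← h, Finset.prod_const, Finset.card_univ, Fintype.card_fin]
  refine pow_le_pow_left₀ (Finset.sum_nonneg fun e _ => by split_ifs <;> linarith)
    (sum_ite_one_le _ hz ?_) m
  simpa using hS

end Words

end EvolvingTree

namespace EvolvingTree

/-! ### Balls of labelings -/

section Balls

variable {V L : Type*} [Fintype V] [DecidableEq V] [Fintype L] [DecidableEq L]
  {T : SimpleGraph V} [DecidableRel T.Adj]

theorem card_sphere_le (hT : T.Connected) {d : ℕ} (hd : ∀ v, T.degree v ≤ d) (u : V) (j : ℕ) :
    (Finset.univ.filter fun v => T.dist v u = j).card ≤ d ^ j := by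
  induction j with
  | zero =>
    have : (Finset.univ.filter fun v => T.dist v u = 0) ⊆ {u} := by
      intro v
      simp [hT.dist_eq_zero_iff]
    simpa using Finset.card_le_card this
  | succ j ih =>
    have : (Finset.univ.filter fun v => T.dist v u = j + 1) ⊆
        (Finset.univ.filter fun v => T.dist v u = j).biUnion fun w => T.neighborFinset w := by
      intro v hv
      have hv := (Finset.mem_filter.1 hv).2
      obtain ⟨p, hp⟩ := hT.exists_walk_length_eq_dist v u
      rw [hv] at hp
      cases p with
      | nil => simp at hp
      | @cons _ w _ h p =>
        simp only [SimpleGraph.Walk.length_cons, add_left_inj] at hp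
        have h1 := SimpleGraph.dist_le p
        have h2 := hT.dist_triangle (u := v) (v := w) (w := u)
        have h3 := SimpleGraph.dist_eq_one_iff_adj.2 h
        simp only [Finset.mem_biUnion, Finset.mem_filter, Finset.mem_univ, true_and,
          SimpleGraph.mem_neighborFinset]
        exact ⟨w, by omega, h.symm⟩
    refine (Finset.card_le_card this).trans
      ((Finset.card_biUnion_le_card_mul _ _ d fun w _ => ?_).trans ?_)
    · simpa using hd w
    · rw [pow_succ]
      exact Nat.mul_le_mul_right d ih

/-- Spheres of radius `j` have at most `d ^ j` points, so a geometric series with ratio `d * x`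
dominates. -/
theorem sum_pow_dist_le (hT : T.Connected) {d : ℕ} (hd : ∀ v, T.degree v ≤ d) (u : V) {x : ℝ}
    (hx : 0 ≤ x) (hx' : d * x ≤ 1 / 2) :
    ∑ v, x ^ T.dist v u ≤ Real.exp (2 * (d * x)) := by
  have hy : 0 ≤ d * x := by positivity
  set s := Finset.univ.image fun v => T.dist v u with hs
  calc ∑ v, x ^ T.dist v u
      = ∑ j ∈ s, ∑ v ∈ Finset.univ.filter fun v => T.dist v u = j, x ^ T.dist v u :=
        (Finset.sum_fiberwise_of_maps_to (fun v _ => Finset.mem_image_of_mem _ (Finset.mem_univ v))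
          _).symm
    _ = ∑ j ∈ s, (Finset.univ.filter fun v => T.dist v u = j).card * x ^ j := by
        refine Finset.sum_congr rfl fun j _ => ?_
        rw [Finset.sum_congr rfl (g := fun _ => x ^ j)]
        · simp
        · intro v hv
          rw [(Finset.mem_filter.1 hv).2]
    _ ≤ ∑ j ∈ s, (d * x) ^ j := by
        refine Finset.sum_le_sum fun j _ => ?_
        rw [mul_pow]
        have := card_sphere_le hT hd u j
        gcongr
        exact_mod_cast this
    _ ≤ (1 - d * x)⁻¹ := by
        rw [← tsum_geometric_of_lt_one hy (by linarith)]
        exact (summable_geometric_of_lt_one hy (by linarith)).sum_le_tsum _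
          fun _ _ => pow_nonneg hy _
    _ ≤ 1 + 2 * (d * x) := by
        rw [inv_le_iff_one_le_mul₀ (by linarith)]
        nlinarith
    _ ≤ _ := by
        rw [add_comm]
        exact Real.add_one_le_exp _

/-- Exponential Markov inequality. Counting all functions `L → V` instead of bijections only
enlarges the ball, and makes the generating function of the distance factor over the labels. -/
theorem card_ball_le (hT : T.Connected) {d : ℕ} (hd : ∀ v, T.degree v ≤ d) (H : L → V) {lam a : ℝ}
    (hlam : 0 ≤ lam) (hx : d * Real.exp (-lam) ≤ 1 / 2) :
    ((Finset.univ.filter fun M : L → V => (labelingDist T M H : ℝ) < a).card : ℝ) ≤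
      Real.exp (lam * a) * Real.exp (2 * (d * Real.exp (-lam))) ^ Fintype.card L := by
  set x := Real.exp (-lam) with hxd
  have h1 : ((Finset.univ.filter fun M : L → V => (labelingDist T M H : ℝ) < a).card : ℝ) *
      Real.exp (-(lam * a)) ≤ ∑ M : L → V, x ^ labelingDist T M H := by
    rw [← nsmul_eq_mul, ← Finset.sum_const]
    refine (Finset.sum_le_sum fun M hM => ?_).trans
      (Finset.sum_le_sum_of_subset_of_nonneg (Finset.filter_subset _ _)
        fun M _ _ => pow_nonneg (Real.exp_pos _).le _)
    rw [hxd, ← Real.exp_nat_mul]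
    have := (Finset.mem_filter.1 hM).2
    gcongr
    nlinarith
  have h2 : ∑ M : L → V, x ^ labelingDist T M H ≤
      Real.exp (2 * (d * Real.exp (-lam))) ^ Fintype.card L := by
    have h := Finset.prod_univ_sum (fun _ : L => (Finset.univ : Finset V))
      (fun l v => x ^ T.dist v (H l))
    rw [Fintype.piFinset_univ] at h
    simp_rw [labelingDist, ← Finset.prod_pow_eq_pow_sum]
    rw [← h, ← Finset.card_univ, ← Finset.prod_const]
    exact Finset.prod_le_prod
      (fun l _ => Finset.sum_nonneg fun v _ => pow_nonneg (Real.exp_pos _).le _)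
      fun l _ => sum_pow_dist_le hT hd _ (Real.exp_pos _).le hx
  rw [Real.exp_neg, ← div_eq_mul_inv] at h1
  rw [div_le_iff₀ (Real.exp_pos _)] at h1
  calc _ ≤ _ := h1
    _ ≤ _ := by
      rw [mul_comm]
      gcongr

end Balls

/-! ### The random swaps -/

section Swaps

variable {V L : Type*} [DecidableEq V] {T : SimpleGraph V}

theorem swapEdge_apply_of_notMem {e : Sym2 V} {v : V} (h : v ∉ e) : swapEdge e v = v := by
  induction e with
  | h a b =>
    simp only [Sym2.mem_iff, not_or] at h
    exact Equiv.swap_apply_of_ne_of_ne h.1 h.2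

theorem trueLabeling_congr (M₀ : L ≃ V) {ξ ξ' : ℕ → T.edgeSet} {m : ℕ}
    (h : ∀ j < m, ξ j = ξ' j) : trueLabeling M₀ ξ m = trueLabeling M₀ ξ' m := by
  induction m with
  | zero => rfl
  | succ m ih =>
    simp only [trueLabeling]
    rw [ih fun j hj => h j (hj.trans m.lt_succ_self), h m m.lt_succ_self]

theorem trueLabeling_add (M₀ : L ≃ V) (ξ : ℕ → T.edgeSet) (j i : ℕ) :
    trueLabeling M₀ ξ (j + i) =
      trueLabeling (trueLabeling M₀ ξ j) (fun l => ξ (j + l)) i := by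
  induction i with
  | zero => rfl
  | succ i ih =>
    rw [← add_assoc]
    simp only [trueLabeling]
    rw [ih]

theorem trueLabeling_of_forall_notMem (M : L ≃ V) {ξ : ℕ → T.edgeSet} {m : ℕ} {l : L}
    (h : ∀ j < m, M l ∉ (ξ j : Sym2 V)) : trueLabeling M ξ m l = M l := by
  induction m with
  | zero => rfl
  | succ m ih =>
    simp only [trueLabeling, Equiv.trans_apply]
    rw [ih fun j hj => h j (hj.trans m.lt_succ_self)]
    exact swapEdge_apply_of_notMem (h m m.lt_succ_self)

/-- An edge that is disjoint from all other swapped edges exchanges its labels for good. -/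
theorem trueLabeling_of_isolated (M : L ≃ V) {ξ : ℕ → T.edgeSet} {m i : ℕ} (hi : i < m) {u v : V}
    (hξ : (ξ i : Sym2 V) = s(u, v))
    (h : ∀ j < m, j ≠ i → u ∉ (ξ j : Sym2 V) ∧ v ∉ (ξ j : Sym2 V)) :
    trueLabeling M ξ m (M.symm u) = v := by
  have h1 : trueLabeling M ξ (i + 1) (M.symm u) = v := by
    simp only [trueLabeling, Equiv.trans_apply]
    rw [trueLabeling_of_forall_notMem M fun j hj => by
      simpa using (h j (hj.trans hi) hj.ne).1, hξ]
    simp [swapEdge]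
  obtain ⟨p, rfl⟩ := Nat.exists_eq_add_of_le hi
  rw [trueLabeling_add, trueLabeling_of_forall_notMem, h1]
  intro j hj
  rw [h1]
  exact (h (i + 1 + j) (by omega) (by omega)).2

/-- A word of edges, continued by a constant. -/
def extendWord {E : Type*} (e₀ : E) {m : ℕ} (w : Fin m → E) (j : ℕ) : E :=
  if h : j < m then w ⟨j, h⟩ else e₀

@[simp] theorem extendWord_val {E : Type*} (e₀ : E) {m : ℕ} (w : Fin m → E) (i : Fin m) :
    extendWord e₀ w i = w i := by
  simp [extendWord]

/-- Two edges with a common endpoint. -/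
def Meets (e f : T.edgeSet) : Prop := ∃ v, v ∈ (e : Sym2 V) ∧ v ∈ (f : Sym2 V)

variable [Fintype V] [DecidableRel T.Adj]

open Classical in
theorem card_meets_le {d : ℕ} (hd : ∀ v, T.degree v ≤ d) (f : T.edgeSet) :
    (Finset.univ.filter fun e => Meets e f).card ≤ 2 * d := by
  obtain ⟨f, hf⟩ := f
  induction f with
  | h a b =>
    rw [← Finset.card_map (Function.Embedding.subtype _)]
    have : (Finset.univ.filter fun e : T.edgeSet => Meets e ⟨s(a, b), hf⟩).map
        (Function.Embedding.subtype _) ⊆ T.incidenceFinset a ∪ T.incidenceFinset b := by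
      intro e he
      simp only [Finset.mem_map, Finset.mem_filter, Finset.mem_univ, true_and] at he
      obtain ⟨e, ⟨v, hv, hv'⟩, rfl⟩ := he
      simp only [Sym2.mem_iff] at hv'
      rcases hv' with rfl | rfl
      · exact Finset.mem_union_left _ (by simpa [SimpleGraph.incidenceSet] using hv)
      · exact Finset.mem_union_right _ (by simpa [SimpleGraph.incidenceSet] using hv)
    refine (Finset.card_le_card this).trans ((Finset.card_union_le _ _).trans ?_)
    rw [SimpleGraph.card_incidenceFinset_eq_degree, SimpleGraph.card_incidenceFinset_eq_degree]
    linarith [hd a, hd b]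

open Classical in
/-- The edges along which the label of the first endpoint moved to the second one. -/
theorem card_swapped_le (M : L ≃ V) (ξ : ℕ → T.edgeSet) (m : ℕ) :
    (Finset.univ.filter fun e : T.edgeSet => ∃ u v, (e : Sym2 V) = s(u, v) ∧
      trueLabeling M ξ m (M.symm u) = v).card ≤ m * 2 := by
  rw [← Finset.card_map (Function.Embedding.subtype _)]
  have : (Finset.univ.filter fun e : T.edgeSet => ∃ u v, (e : Sym2 V) = s(u, v) ∧
      trueLabeling M ξ m (M.symm u) = v).map (Function.Embedding.subtype _) ⊆
      ((Finset.range m).biUnion fun j => (ξ j : Sym2 V).toFinset).image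
        fun u => s(u, trueLabeling M ξ m (M.symm u)) := by
    intro e he
    simp only [Finset.mem_map, Finset.mem_filter, Finset.mem_univ, true_and] at he
    obtain ⟨⟨e, he'⟩, ⟨u, v, rfl, huv⟩, rfl⟩ := he
    refine Finset.mem_image.2 ⟨u, ?_, by simp [huv]⟩
    by_contra hu
    simp only [Finset.mem_biUnion, Finset.mem_range, Sym2.mem_toFinset, not_exists, not_and] at hu
    rw [trueLabeling_of_forall_notMem M (by simpa using hu)] at huv
    simp only [Equiv.apply_symm_apply] at huv
    exact (T.mem_edgeSet.1 he').ne huv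
  refine (Finset.card_le_card this).trans (Finset.card_image_le.trans ?_)
  refine (Finset.card_biUnion_le_card_mul _ _ 2 fun j _ => ?_).trans (by simp)
  rw [Sym2.card_toFinset]
  split_ifs <;> omega

open Classical in
-- Each position of such a word meets an earlier letter, meets a later letter, or carries a letter
-- of a set `S` determined by `M` and `M'`. One of the three kinds occurs at least `r` times, and
-- each kind is counted by its generating function.
theorem card_words_le {d r : ℕ} (hd : ∀ v, T.degree v ≤ d) (hd1 : 1 ≤ d) (hr : 0 < r)
    (hq : (6 * d * r : ℝ) ≤ Fintype.card T.edgeSet) (e₀ : T.edgeSet) (M : L ≃ V) (M' : L → V)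
    [DecidablePred fun w : Fin (3 * r) → T.edgeSet =>
      ⇑(trueLabeling M (extendWord e₀ w) (3 * r)) = M'] :
    ((Finset.univ.filter fun w : Fin (3 * r) → T.edgeSet =>
        ⇑(trueLabeling M (extendWord e₀ w) (3 * r)) = M').card : ℝ) ≤
      3 * ((2 * Fintype.card T.edgeSet) ^ (3 * r) * (6 * d * r / Fintype.card T.edgeSet) ^ r) := by
  have hq0 : (0 : ℝ) < 6 * d * r := by positivity
  have hz : (0 : ℝ) ≤ Fintype.card T.edgeSet / (6 * d * r) := by positivity
  have hmul : ((3 * r : ℕ) * (2 * d : ℕ) : ℝ) ≤ 6 * d * r := by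
    push_cast
    linarith
  -- A single word producing `M'` suffices to bound `S`: its `3 * r` swaps touch at most `6 * r`
  -- vertices.
  by_cases hne : ∃ w : Fin (3 * r) → T.edgeSet,
    ⇑(trueLabeling M (extendWord e₀ w) (3 * r)) = M'
  swap
  · push Not at hne
    rw [Finset.filter_false_of_mem fun w _ => hne w]
    simp only [Finset.card_empty, Nat.cast_zero]
    positivity
  obtain ⟨w₀, hw₀⟩ := hne
  set S := Finset.univ.filter fun e : T.edgeSet => ∃ u v, (e : Sym2 V) = s(u, v) ∧
      M' (M.symm u) = v with hS
  have hScard : (S.card : ℝ) ≤ 6 * d * r := by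
    have h := card_swapped_le M (extendWord e₀ w₀) (3 * r)
    rw [hw₀] at h
    refine le_trans (Nat.cast_le.2 h) ?_
    push_cast
    have : (1 : ℝ) ≤ d := by exact_mod_cast hd1
    nlinarith [(Nat.cast_nonneg r : (0 : ℝ) ≤ r)]
  have hE := card_filter_le_of_sum_le (r := r) hq0 hq _
    (sum_prod_earlier_le Meets hz (card_meets_le hd) (3 * r) hmul)
  have hL := card_filter_le_of_sum_le (r := r) hq0 hq _
    (sum_prod_later_le Meets hz (card_meets_le hd) (3 * r) hmul)
  have hI := card_filter_le_of_sum_le (r := r) hq0 hq _ (sum_prod_mem_le S hz hScard (3 * r))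
  rw [show ∀ x : ℝ, 3 * x = x + x + x from fun x => by ring]
  refine le_trans ?_ (add_le_add (add_le_add hE hL) hI)
  norm_cast
  refine le_trans (Finset.card_le_card ?_) ((Finset.card_union_le _ _).trans
    (Nat.add_le_add_right (Finset.card_union_le _ _) _))
  intro w hw
  have hw := (Finset.mem_filter.1 hw).2
  -- A letter that meets no other letter exchanges its two labels permanently, so `M'` reveals it.
  have hcover : (Finset.univ : Finset (Fin (3 * r))) ⊆
      (Finset.univ.filter fun i => ∃ j, j < i ∧ Meets (w i) (w j)) ∪
      (Finset.univ.filter fun i => ∃ j, i < j ∧ Meets (w i) (w j)) ∪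
      (Finset.univ.filter fun i => w i ∈ S) := by
    intro i _
    simp only [Finset.mem_union, Finset.mem_filter, Finset.mem_univ, true_and]
    by_contra hcon
    simp only [not_or, not_exists, not_and] at hcon
    obtain ⟨⟨h1, h2⟩, h3⟩ := hcon
    refine h3 ?_
    obtain ⟨⟨u, v⟩, huv⟩ : ∃ p : V × V, (w i : Sym2 V) = s(p.1, p.2) :=
      ⟨(w i : Sym2 V).out, (Quot.out_eq (w i : Sym2 V)).symm⟩
    rw [hS, Finset.mem_filter]
    refine ⟨Finset.mem_univ _, u, v, huv, ?_⟩
    rw [← hw]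
    refine trueLabeling_of_isolated M i.2 (by simpa using huv) fun j hj hji => ?_
    have hnm : ¬ Meets (w i) (w ⟨j, hj⟩) := by
      rcases lt_or_gt_of_ne hji with hlt | hlt
      · exact h1 ⟨j, hj⟩ hlt
      · exact h2 ⟨j, hj⟩ hlt
    have hval : extendWord e₀ w j = w ⟨j, hj⟩ := extendWord_val e₀ w ⟨j, hj⟩
    rw [hval]
    exact ⟨fun hu => hnm ⟨u, by simp [huv], hu⟩, fun hv => hnm ⟨v, by simp [huv], hv⟩⟩
  have hc := (Finset.card_le_card hcover).trans ((Finset.card_union_le _ _).trans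
    (Nat.add_le_add_right (Finset.card_union_le _ _) _))
  simp only [Finset.card_univ, Fintype.card_fin] at hc
  simp only [Finset.mem_union, Finset.mem_filter, Finset.mem_univ, true_and]
  by_contra hcon
  simp only [not_or, not_le] at hcon
  omega

end Swaps

end EvolvingTree

namespace EvolvingTree

/-! ### Runs of the algorithm -/

section Answers

variable {V L : Type*} [DecidableEq V] [Fintype V] {T : SimpleGraph V} [DecidableRel T.Adj]

variable (T) in
/-- The possible answers of the oracle to a query at the vertex `u`. -/
def answers (u : V) : Finset (Option (Sym2 V)) :=
  insert none ((T.neighborFinset u).image fun v => some s(u, v))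

theorem card_answers_le {d : ℕ} (hd : ∀ v, T.degree v ≤ d) (u : V) :
    (answers T u).card ≤ d + 1 := by
  refine (Finset.card_insert_le _ _).trans (Nat.add_le_add_right (Finset.card_image_le.trans ?_) 1)
  simpa using hd u

theorem oracle_mem_answers (hT : T.IsTree) (M : L ≃ V) (l : L) (u : V) :
    oracle hT M l u ∈ answers T u := by
  unfold oracle
  split_ifs with h
  · exact Finset.mem_insert_self _ _
  · refine Finset.mem_insert_of_mem (Finset.mem_image.2 ⟨_, ?_, rfl⟩)
    rw [SimpleGraph.mem_neighborFinset]
    exact SimpleGraph.Walk.adj_snd (SimpleGraph.Walk.not_nil_of_ne (Ne.symm h))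

end Answers

section Runs

variable {V L S : Type*} [DecidableEq V] [DecidableEq L] [MeasurableSpace S]
  {T : SimpleGraph V}

theorem run_congr (hT : T.IsTree) {c : ℝ} (hc : 0 < c) (A : ProbeMoveAlgorithm T L S) (s : S)
    (M₀ : L ≃ V) (H₀ : L → V) {ξ ξ' : ℕ → T.edgeSet} {m : ℕ}
    (h : ∀ j < ⌊(m : ℝ) / c⌋₊, ξ j = ξ' j) :
    run hT c A s M₀ H₀ ξ m = run hT c A s M₀ H₀ ξ' m := by
  induction m with
  | zero => rfl
  | succ m ih =>
    have hm : ⌊(m : ℝ) / c⌋₊ ≤ ⌊((m + 1 : ℕ) : ℝ) / c⌋₊ := by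
      refine Nat.floor_le_floor ?_
      gcongr
      simp
    simp only [run]
    rw [ih fun j hj => h j (hj.trans_le hm), trueLabeling_congr M₀ h]

theorem distAt_congr [Fintype L] (hT : T.IsTree) {c : ℝ} (hc : 0 < c)
    (A : ProbeMoveAlgorithm T L S) (s : S) (M₀ : L ≃ V) (H₀ : L → V) {ξ ξ' : ℕ → T.edgeSet} {t : ℝ}
    (ht : 0 ≤ t) (h : ∀ j < ⌊t / c⌋₊, ξ j = ξ' j) :
    distAt hT c A s M₀ H₀ ξ t = distAt hT c A s M₀ H₀ ξ' t := by
  have hle : ⌊(⌊t⌋₊ : ℝ) / c⌋₊ ≤ ⌊t / c⌋₊ := by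
    refine Nat.floor_le_floor ?_
    gcongr
    exact Nat.floor_le ht
  rw [distAt, distAt, trueLabeling_congr M₀ h, run_congr hT hc A s M₀ H₀
    fun j hj => h j (hj.trans_le hle)]

/-- The state after one step in which the oracle gives the answer `a`. -/
def stepState (A : ProbeMoveAlgorithm T L S) (s : S) (y : List (Probe L V) × (L → V))
    (a : Option (Sym2 V)) : List (Probe L V) × (L → V) :=
  ((A.query s y.1 y.2, a) :: y.1, Function.update y.2 (A.query s y.1 y.2).1
    (A.move s y.1 y.2 (A.query s y.1 y.2) a))

theorem run_succ (hT : T.IsTree) (c : ℝ) (A : ProbeMoveAlgorithm T L S) (s : S)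
    (M₀ : L ≃ V) (H₀ : L → V) (ξ : ℕ → T.edgeSet) (m : ℕ) :
    run hT c A s M₀ H₀ ξ (m + 1) = stepState A s (run hT c A s M₀ H₀ ξ m)
      (oracle hT (trueLabeling M₀ ξ ⌊((m + 1 : ℕ) : ℝ) / c⌋₊)
        (A.query s (run hT c A s M₀ H₀ ξ m).1 (run hT c A s M₀ H₀ ξ m).2).1
        (A.query s (run hT c A s M₀ H₀ ξ m).1 (run hT c A s M₀ H₀ ξ m).2).2) := rfl

/-- There are only countably many states, so the event splits into countably many cases according to
the previous state, the query and the move. -/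
theorem measurableSet_run_eq [Fintype V] [Fintype L] (hT : T.IsTree) (c : ℝ)
    (A : ProbeMoveAlgorithm T L S) (M₀ : L ≃ V) (H₀ : L → V) (ξ : ℕ → T.edgeSet) (m : ℕ)
    (y : List (Probe L V) × (L → V)) :
    MeasurableSet {s | run hT c A s M₀ H₀ ξ m = y} := by
  induction m generalizing y with
  | zero =>
    simp only [run]
    exact MeasurableSet.const _
  | succ m ih =>
    set a : L × V → Option (Sym2 V) := fun q =>
      oracle hT (trueLabeling M₀ ξ ⌊((m + 1 : ℕ) : ℝ) / c⌋₊) q.1 q.2 with ha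
    have : {s | run hT c A s M₀ H₀ ξ (m + 1) = y} =
        ⋃ x : List (Probe L V) × (L → V), ⋃ q : L × V, ⋃ v : V,
          ({s | run hT c A s M₀ H₀ ξ m = x} ∩ {s | A.query s x.1 x.2 = q} ∩
            {s | A.move s x.1 x.2 q (a q) = v}) ∩
            {_s | ((q, a q) :: x.1, Function.update x.2 q.1 v) = y} := by
      ext s
      simp only [Set.mem_iUnion, Set.mem_inter_iff, Set.mem_ofPred_eq, run_succ, stepState]
      constructor
      · intro h
        exact ⟨_, _, _, ⟨⟨rfl, rfl⟩, rfl⟩, h⟩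
      · rintro ⟨x, q, v, ⟨⟨rfl, rfl⟩, rfl⟩, h⟩
        exact h
    rw [this]
    exact MeasurableSet.iUnion fun x => MeasurableSet.iUnion fun q => MeasurableSet.iUnion fun v =>
      (((ih x).inter (A.measurable_query _ _ _)).inter (A.measurable_move _ _ _ _ _)).inter
        (MeasurableSet.const _)

theorem measurableSet_distAt_lt [Fintype V] [Fintype L] (hT : T.IsTree) (c : ℝ)
    (A : ProbeMoveAlgorithm T L S) (M₀ : L ≃ V) (H₀ : L → V) (ξ : ℕ → T.edgeSet) (t x : ℝ) :
    MeasurableSet {s | (distAt hT c A s M₀ H₀ ξ t : ℝ) < x} := by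
  have : {s | (distAt hT c A s M₀ H₀ ξ t : ℝ) < x} =
      ⋃ y : List (Probe L V) × (L → V), {s | run hT c A s M₀ H₀ ξ ⌊t⌋₊ = y} ∩
        {_s | (labelingDist T (trueLabeling M₀ ξ ⌊t / c⌋₊) y.2 : ℝ) < x} := by
    ext s
    simp [distAt]
  rw [this]
  exact MeasurableSet.iUnion fun y =>
    (measurableSet_run_eq hT c A M₀ H₀ ξ _ y).inter (MeasurableSet.const _)

variable [Fintype V] [DecidableRel T.Adj] [Fintype L]

/-- The states that the algorithm can reach in `p` steps, whatever the oracle answers. -/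
def reachableStates (A : ProbeMoveAlgorithm T L S) (s : S) (x : List (Probe L V) × (L → V)) :
    ℕ → Finset (List (Probe L V) × (L → V))
  | 0 => {x}
  | p + 1 => (reachableStates A s x p).biUnion fun y =>
      (answers T (A.query s y.1 y.2).2).image (stepState A s y)

theorem card_reachableStates_le {d : ℕ} (hd : ∀ v, T.degree v ≤ d)
    (A : ProbeMoveAlgorithm T L S) (s : S) (x : List (Probe L V) × (L → V)) (p : ℕ) :
    (reachableStates A s x p).card ≤ (d + 1) ^ p := by
  induction p with
  | zero => simp [reachableStates]
  | succ p ih =>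
    refine (Finset.card_biUnion_le_card_mul _ _ (d + 1) fun y _ =>
      Finset.card_image_le.trans (card_answers_le hd _)).trans ?_
    rw [pow_succ]
    exact Nat.mul_le_mul_right _ ih

theorem run_mem_reachableStates (hT : T.IsTree) (c : ℝ) (A : ProbeMoveAlgorithm T L S) (s : S)
    (M₀ : L ≃ V) (H₀ : L → V) (ξ : ℕ → T.edgeSet) (m p : ℕ) :
    run hT c A s M₀ H₀ ξ (m + p) ∈ reachableStates A s (run hT c A s M₀ H₀ ξ m) p := by
  induction p with
  | zero => simp [reachableStates]
  | succ p ih =>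
    rw [← add_assoc, run_succ]
    exact Finset.mem_biUnion.2 ⟨_, ih, Finset.mem_image_of_mem _ (oracle_mem_answers hT _ _ _)⟩

/-- The concatenation of two words, continued by a constant. -/
def concatWord {E : Type*} (e₀ : E) {i m : ℕ} (a : Fin i → E) (w : Fin m → E) (j : ℕ) : E :=
  if j < i then extendWord e₀ a j else extendWord e₀ w (j - i)

/-- For a fixed seed and fixed early swaps, few continuations lead to a small distance. -/
theorem card_distAt_lt_le (hT : T.IsTree) {c : ℝ} (hc : 0 < c) (A : ProbeMoveAlgorithm T L S)
    (s : S) (M₀ : L ≃ V) (H₀ : L → V) {d r i p : ℕ} (hd : ∀ v, T.degree v ≤ d) (hd1 : 1 ≤ d)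
    (hr : 0 < r) (hq : (6 * d * r : ℝ) ≤ Fintype.card T.edgeSet) (e₀ : T.edgeSet) {t : ℝ}
    (hi : i + 3 * r = ⌊t / c⌋₊) (hp : ⌊t⌋₊ ≤ ⌊i * c⌋₊ + p)
    (a : Fin i → T.edgeSet) {lam x : ℝ} (hlam : 0 ≤ lam) (hx : d * Real.exp (-lam) ≤ 1 / 2) :
    ((Finset.univ.filter fun w : Fin (3 * r) → T.edgeSet =>
        (distAt hT c A s M₀ H₀ (concatWord e₀ a w) t : ℝ) < x).card : ℝ) ≤
      (d + 1) ^ p * ((Real.exp (lam * x) *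
        Real.exp (2 * (d * Real.exp (-lam))) ^ Fintype.card L) *
      (3 * ((2 * Fintype.card T.edgeSet) ^ (3 * r) *
        (6 * d * r / Fintype.card T.edgeSet) ^ r))) := by
  set C₁ := Real.exp (lam * x) * Real.exp (2 * (d * Real.exp (-lam))) ^ Fintype.card L with hC₁
  set C₂ := 3 * ((2 * (Fintype.card T.edgeSet : ℝ)) ^ (3 * r) *
        (6 * d * r / Fintype.card T.edgeSet) ^ r) with hC₂
  have hC₁0 : 0 ≤ C₁ := by positivity
  have hC₂0 : 0 ≤ C₂ := by positivity
  have ht : 0 ≤ t := by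
    by_contra ht
    have : ⌊t / c⌋₊ = 0 := Nat.floor_of_nonpos (div_nonpos_of_nonpos_of_nonneg (by linarith) hc.le)
    omega
  set ξ₀ : ℕ → T.edgeSet := extendWord e₀ a
  set m₀ := ⌊i * c⌋₊ with hm₀
  set x₀ := run hT c A s M₀ H₀ ξ₀ m₀
  set M₁ := trueLabeling M₀ ξ₀ i
  -- Up to step `m₀` the oracle has used at most the first `i` swaps, so the state `x₀` does not
  -- depend on `w`.
  have hm₀i : ⌊(m₀ : ℝ) / c⌋₊ ≤ i := by
    refine Nat.floor_le_of_le ?_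
    rw [div_le_iff₀ hc]
    exact Nat.floor_le (by positivity)
  have hm₀t : m₀ ≤ ⌊t⌋₊ := by
    refine Nat.floor_le_floor ?_
    rw [← le_div_iff₀ hc]
    refine le_trans ?_ (Nat.floor_le (by positivity))
    rw [← hi]
    push_cast
    linarith [(Nat.cast_nonneg r : (0 : ℝ) ≤ r)]
  obtain ⟨p', hp'⟩ := Nat.exists_eq_add_of_le hm₀t
  have hpp : p' ≤ p := by omega
  have hsub : (Finset.univ.filter fun w : Fin (3 * r) → T.edgeSet =>
        (distAt hT c A s M₀ H₀ (concatWord e₀ a w) t : ℝ) < x) ⊆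
      (reachableStates A s x₀ p').biUnion fun y =>
        (Finset.univ.filter fun M : L → V => (labelingDist T M y.2 : ℝ) < x).biUnion fun M =>
          Finset.univ.filter fun w : Fin (3 * r) → T.edgeSet =>
            ⇑(trueLabeling M₁ (extendWord e₀ w) (3 * r)) = M := by
    intro w hw
    have hw := (Finset.mem_filter.1 hw).2
    have hearly : ∀ j < i, concatWord e₀ a w j = ξ₀ j := fun j hj => by
      simp [concatWord, hj, ξ₀]
    have hM : trueLabeling M₀ (concatWord e₀ a w) ⌊t / c⌋₊ =
        trueLabeling M₁ (extendWord e₀ w) (3 * r) := by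
      rw [← hi, trueLabeling_add, trueLabeling_congr M₀ hearly]
      congr 1
      funext l
      simp [concatWord]
    have hrun : run hT c A s M₀ H₀ (concatWord e₀ a w) m₀ = x₀ :=
      run_congr hT hc A s M₀ H₀ fun j hj => hearly j (hj.trans_le hm₀i)
    refine Finset.mem_biUnion.2 ⟨run hT c A s M₀ H₀ (concatWord e₀ a w) ⌊t⌋₊, ?_, ?_⟩
    · rw [hp', ← hrun]
      exact run_mem_reachableStates hT c A s M₀ H₀ _ m₀ p'
    · refine Finset.mem_biUnion.2 ⟨_, ?_, Finset.mem_filter.2 ⟨Finset.mem_univ _, rfl⟩⟩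
      rw [Finset.mem_filter, ← hM]
      exact ⟨Finset.mem_univ _, hw⟩
  have hinner : ∀ y : List (Probe L V) × (L → V),
      ((((Finset.univ.filter fun M : L → V => (labelingDist T M y.2 : ℝ) < x).biUnion fun M =>
          Finset.univ.filter fun w : Fin (3 * r) → T.edgeSet =>
            ⇑(trueLabeling M₁ (extendWord e₀ w) (3 * r)) = M).card : ℕ) : ℝ) ≤ C₁ * C₂ := by
    intro y
    refine le_trans (Nat.cast_le.2 Finset.card_biUnion_le) ?_
    push_cast
    refine (Finset.sum_le_card_nsmul _ _ C₂ fun M _ =>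
      card_words_le hd hd1 hr hq e₀ M₁ M).trans ?_
    rw [nsmul_eq_mul]
    exact mul_le_mul_of_nonneg_right (card_ball_le hT.1 hd y.2 hlam hx) hC₂0
  refine le_trans (Nat.cast_le.2 ((Finset.card_le_card hsub).trans Finset.card_biUnion_le)) ?_
  push_cast
  refine (Finset.sum_le_card_nsmul _ _ (C₁ * C₂) fun y _ => hinner y).trans ?_
  rw [nsmul_eq_mul]
  refine mul_le_mul_of_nonneg_right ?_ (by positivity)
  calc ((reachableStates A s x₀ p').card : ℝ) ≤ (d + 1) ^ p' := by
        exact_mod_cast card_reachableStates_le hd A s x₀ p'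
    _ ≤ _ := pow_le_pow_right₀ (by simp) hpp

end Runs

end EvolvingTree

namespace EvolvingTree

/-! ### From counting to probability -/

section Probability

/-- Integrate the pointwise count. This turns a bound for every seed into one for a random seed. -/
theorem sum_measureReal_le {Ω ι : Type*} [MeasurableSpace Ω] [Fintype ι] (P : Measure Ω)
    [IsProbabilityMeasure P] (C : ι → Set Ω) (hC : ∀ i, MeasurableSet (C i)) {ρ : ℝ}
    [∀ ω, DecidablePred fun i => ω ∈ C i]
    (h : ∀ ω, ((Finset.univ.filter fun i => ω ∈ C i).card : ℝ) ≤ ρ) :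
    ∑ i, P.real (C i) ≤ ρ := by
  have hint : ∀ i ∈ (Finset.univ : Finset ι), Integrable ((C i).indicator (1 : Ω → ℝ)) P :=
    fun i _ => (integrable_const (1 : ℝ)).indicator (hC i)
  calc ∑ i, P.real (C i) = ∑ i, ∫ ω, (C i).indicator (1 : Ω → ℝ) ω ∂P :=
        Finset.sum_congr rfl fun i _ => (integral_indicator_one (hC i)).symm
    _ = ∫ ω, ∑ i, (C i).indicator (1 : Ω → ℝ) ω ∂P := (integral_finsetSum _ hint).symm
    _ ≤ ∫ _, ρ ∂P := by
        refine integral_mono (integrable_finsetSum _ hint) (integrable_const ρ) fun ω => ?_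
        refine le_of_eq_of_le ?_ (h ω)
        simp [Set.indicator_apply]
    _ = ρ := by simp

variable {V S Ω : Type*} {T : SimpleGraph V} [MeasurableSpace S] [MeasurableSpace Ω]
  {P : Measure Ω} {ξ : ℕ → Ω → T.edgeSet} {R : Ω → S}

theorem IsUniformEvolver.measureReal_forall_eq (hξ : IsUniformEvolver P T ξ)
    (g : ℕ → T.edgeSet) (J : ℕ) :
    P.real {ω | ∀ j < J, ξ j ω = g j} = (1 / (Nat.card T.edgeSet : ℝ)) ^ J := by
  have h := hξ.indep.measure_inter_preimage_eq_mul (Finset.range J) (sets := fun j => {g j})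
    fun _ _ => trivial
  have hset : {ω | ∀ j < J, ξ j ω = g j} = ⋂ j ∈ Finset.range J, ξ j ⁻¹' {g j} := by
    ext ω
    simp
  rw [hset, measureReal_def, h, ENNReal.toReal_prod]
  exact (Finset.prod_congr rfl fun j _ => hξ.uniform j (g j)).trans (by simp)

/-- If for each seed and each beginning of the evolver's run there are few bad continuations, then
a bad run is unlikely. -/
theorem measureReal_le_of_card_le [IsProbabilityMeasure P] [Fintype T.edgeSet]
    (hξ : IsUniformEvolver P T ξ) (hR : Measurable R) (hind : IndepFun R (fun ω j => ξ j ω) P)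
    (e₀ : T.edgeSet) {i m : ℕ}
    (B : (ℕ → T.edgeSet) → Set S) (hB : ∀ g, MeasurableSet (B g))
    (hBc : ∀ g g', (∀ j < i + m, g j = g' j) → B g = B g') {ρ : ℝ}
    [∀ s (a : Fin i → T.edgeSet), DecidablePred fun w : Fin m → T.edgeSet =>
      s ∈ B (concatWord e₀ a w)]
    (h : ∀ s (a : Fin i → T.edgeSet), ((Finset.univ.filter fun w : Fin m → T.edgeSet =>
      s ∈ B (concatWord e₀ a w)).card : ℝ) ≤ ρ) :
    P.real {ω | R ω ∈ B fun j => ξ j ω} ≤ ρ / (Fintype.card T.edgeSet : ℝ) ^ m := by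
  classical
  have hN : (0 : ℝ) < Fintype.card T.edgeSet := by
    exact_mod_cast Fintype.card_pos_iff.2 ⟨e₀⟩
  set N : ℝ := ((Fintype.card T.edgeSet : ℕ) : ℝ) with hNdef
  set cat : (Fin i → T.edgeSet) × (Fin m → T.edgeSet) → ℕ → T.edgeSet :=
    fun x => concatWord e₀ x.1 x.2 with hcat
  have hsub : {ω | R ω ∈ B fun j => ξ j ω} ⊆
      ⋃ x : (Fin i → T.edgeSet) × (Fin m → T.edgeSet),
        (R ⁻¹' B (cat x) ∩ {ω | ∀ j < i + m, ξ j ω = cat x j}) := by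
    intro ω hω
    set x : (Fin i → T.edgeSet) × (Fin m → T.edgeSet) :=
      (fun j => ξ j ω, fun j => ξ (i + j) ω) with hx
    have hxe : ∀ j < i + m, ξ j ω = cat x j := by
      intro j hj
      by_cases hji : j < i
      · simp [hcat, hx, concatWord, extendWord, hji]
      · have h1 : j - i < m := by omega
        have h2 : i + (j - i) = j := by omega
        simp [hcat, hx, concatWord, extendWord, hji, h1, h2]
    refine Set.mem_iUnion.2 ⟨x, ?_, hxe⟩
    have hω : R ω ∈ B fun j => ξ j ω := hω
    rwa [hBc _ _ hxe] at hω
  -- With the edge word frozen, the bad event concerns the seed alone, which is independent of the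
  -- swaps.
  have hterm : ∀ x, P.real (R ⁻¹' B (cat x) ∩ {ω | ∀ j < i + m, ξ j ω = cat x j}) =
      P.real (R ⁻¹' B (cat x)) * (1 / N) ^ (i + m) := by
    intro x
    have hmeas : MeasurableSet {f : ℕ → T.edgeSet | ∀ j < i + m, f j = cat x j} := by
      have : {f : ℕ → T.edgeSet | ∀ j < i + m, f j = cat x j} =
          ⋂ j, ⋂ (_ : j < i + m), (fun f : ℕ → T.edgeSet => f j) ⁻¹' {cat x j} := by
        ext f
        simp
      rw [this]
      exact MeasurableSet.iInter fun j => MeasurableSet.iInter fun _ =>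
        measurable_pi_apply j trivial
    have h1 := hind.measure_inter_preimage_eq_mul _ _ (hB (cat x)) hmeas
    have h2 := hξ.measureReal_forall_eq (cat x) (i + m)
    rw [Nat.card_eq_fintype_card] at h2
    rw [← h2, measureReal_def, measureReal_def, measureReal_def, ← ENNReal.toReal_mul]
    exact congrArg ENNReal.toReal h1
  have hsum : ∀ a : Fin i → T.edgeSet,
      ∑ w : Fin m → T.edgeSet, P.real (R ⁻¹' B (cat (a, w))) ≤ ρ := fun a => by
    refine sum_measureReal_le P _ (fun w => hR (hB _)) fun ω => ?_
    convert h (R ω) a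
    exact Iff.rfl
  calc P.real {ω | R ω ∈ B fun j => ξ j ω}
      ≤ ∑ x, P.real (R ⁻¹' B (cat x) ∩ {ω | ∀ j < i + m, ξ j ω = cat x j}) :=
        (measureReal_mono hsub).trans (measureReal_iUnion_fintype_le _)
    _ = (∑ a, ∑ w, P.real (R ⁻¹' B (cat (a, w)))) * (1 / N) ^ (i + m) := by
        simp_rw [hterm]
        rw [← Finset.sum_mul, Fintype.sum_prod_type]
    _ ≤ (∑ _a : Fin i → T.edgeSet, ρ) * (1 / N) ^ (i + m) := by
        refine mul_le_mul_of_nonneg_right (Finset.sum_le_sum fun a _ => hsum a) (by positivity)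
    _ = ρ / N ^ m := by
        rw [Finset.sum_const, Finset.card_univ, Fintype.card_fun, Fintype.card_fin, nsmul_eq_mul]
        push_cast
        rw [← hNdef, pow_add, one_div_pow, one_div_pow]
        field_simp

end Probability

/-! ### The choice of constants -/

/-- Here `288 = 3 * 8 * 12`: the factor `3` is at most `3 ^ r`, `8 ^ r` is `2 ^ (3 * r)`, and `12 *
d * δ` bounds `6 * d * r / N` because `N ≥ n / 2`. -/
theorem failure_bound {n N B A δ X G : ℝ} {r p C : ℕ} (hN : n / 2 ≤ N) (hn : 0 < n)
    {d : ℝ} (hd : 0 < d) (hB : 1 ≤ B) (hX : 0 ≤ X) (hG : 0 ≤ G) (hr : 0 < r)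
    (hrδ : (r : ℝ) ≤ δ * n) (hp : p ≤ r * C) (hA : A = B ^ C * (288 * d)) :
    B ^ p * ((X * G) * (3 * ((2 * N) ^ (3 * r) * (6 * d * r / N) ^ r))) / N ^ (3 * r) ≤
      (A * δ) ^ r * (X * G) := by
  have hN0 : 0 < N := by linarith
  have h1 : B ^ p ≤ (B ^ C) ^ r := by
    rw [← pow_mul, mul_comm C]
    exact pow_le_pow_right₀ hB hp
  have h2 : 6 * d * r / N ≤ 12 * d * δ := by
    rw [div_le_iff₀ hN0]
    have hδ : 0 ≤ δ := by
      by_contra hδ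
      have : (0 : ℝ) ≤ r := Nat.cast_nonneg r
      nlinarith [mul_pos (neg_pos.2 (not_le.1 hδ)) hn, (Nat.cast_pos.2 hr : (0 : ℝ) < r)]
    have h3 : d * δ * (n / 2) ≤ d * δ * N := by gcongr
    have h4 : d * r ≤ d * (δ * n) := by gcongr
    nlinarith
  have h3 : (3 : ℝ) ≤ 3 ^ r := le_self_pow₀ (by norm_num) hr.ne'
  calc B ^ p * ((X * G) * (3 * ((2 * N) ^ (3 * r) * (6 * d * r / N) ^ r))) / N ^ (3 * r)
      = B ^ p * 3 * 8 ^ r * (6 * d * r / N) ^ r * (X * G) := by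
        rw [mul_pow, pow_mul 2 3 r]
        norm_num
        field_simp
    _ ≤ (B ^ C) ^ r * 3 ^ r * 8 ^ r * (12 * d * δ) ^ r * (X * G) := by
        gcongr
    _ = (A * δ) ^ r * (X * G) := by
        rw [← mul_pow, ← mul_pow, ← mul_pow, hA]
        congr 2
        ring

end EvolvingTree

theorem mainTheorem1 (k : ℕ) (c : ℝ) (hc : 1 ≤ c) :
    ∃ α β K : ℝ, 0 < α ∧ 0 < β ∧ 0 < K ∧ ∃ N : ℕ, ∀ n : ℕ, N ≤ n →
      ∀ (V L : Type*) [Fintype V] [DecidableEq V] [Fintype L] [DecidableEq L]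
        (T : SimpleGraph V) [DecidableRel T.Adj] (hT : T.IsTree),
        Fintype.card V = n → (∀ v, T.degree v ≤ k) →
      ∀ (S Ω : Type*) [MeasurableSpace S] [MeasurableSpace Ω]
        (A : ProbeMoveAlgorithm T L S) (M₀ : L ≃ V) (H₀ : L → V)
        (P : Measure Ω) [IsProbabilityMeasure P] (ξ : ℕ → Ω → T.edgeSet) (R : Ω → S),
        IsUniformEvolver P T ξ → Measurable R → IndepFun R (fun ω j => ξ j ω) P →
      ∀ t : ℝ, K * n ≤ t →
        1 - Real.exp (-β * n) ≤
          P.real {ω | α * n ≤ (distAt hT c A (R ω) M₀ H₀ (fun j => ξ j ω) t : ℝ)} := by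
  have hc0 : 0 < c := by linarith
  -- The shift ensures `1 ≤ d` even for `k = 0`.
  set d : ℕ := k + 1 with hddef
  have hd1 : (1 : ℝ) ≤ d := by simp [hddef]
  -- The last `3 * r` swaps leave room for at most `(3 * r + 1) * c + 1` steps, roundings included;
  -- this is at most `r * (4 * c + 1)` since `r ≥ 1`.
  set C : ℕ := ⌈4 * c + 1⌉₊ with hC
  set B : ℝ := d + 1 with hB
  have hB1 : 1 ≤ B := by linarith
  set A₀ : ℝ := B ^ C * (288 * d) with hA₀
  have hA₀1 : 288 * d ≤ A₀ := le_mul_of_one_le_left (by positivity) (one_le_pow₀ hB1)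
  have hA₀0 : 0 < A₀ := by linarith
  set δ : ℝ := Real.exp (-3) / A₀ with hδ
  have hδ0 : 0 < δ := by positivity
  have hAδ : A₀ * δ = Real.exp (-3) := by
    rw [hδ]
    field_simp
  have hdδ : 288 * d * δ ≤ 1 := by
    calc 288 * d * δ ≤ A₀ * δ := by gcongr
      _ = Real.exp (-3) := hAδ
      _ ≤ 1 := Real.exp_le_one_iff.2 (by norm_num)
  have hδ1 : δ ≤ 1 := by nlinarith
  set lam : ℝ := Real.log (8 * d / δ) with hlam
  have hlam0 : 0 < lam := by
    refine Real.log_pos ?_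
    rw [lt_div_iff₀ hδ0]
    linarith
  have hexp : Real.exp (-lam) = δ / (8 * d) := by
    rw [Real.exp_neg, hlam, Real.exp_log (by positivity), inv_div]
  have hdexp : d * Real.exp (-lam) = δ / 8 := by
    rw [hexp]
    field_simp
  -- `α` and `lam` are chosen so that the two factors of the ball bound are each `exp (δ * n / 4)`.
  -- `K` guarantees `3 * r` swaps before `t`, and the threshold for `n` gives `δ * n ≥ 2`, hence `r
  -- ≥ δ * n / 2`.
  refine ⟨δ / (4 * lam), δ, 3 * δ * c, by positivity, hδ0, by positivity, ⌈2 / δ⌉₊ + 2, ?_⟩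
  intro n hn V L _ _ _ _ T _ hT hV hk S Ω _ _ A M₀ H₀ P _ ξ R hξ hR hind t ht
  have hn2 : (2 : ℝ) ≤ n := by
    exact_mod_cast (Nat.le_add_left 2 _).trans hn
  have hδn : 2 ≤ δ * n := by
    have h1 : 2 / δ ≤ n := (Nat.le_ceil _).trans (by exact_mod_cast (Nat.le_add_right _ 2).trans hn)
    rw [div_le_iff₀ hδ0] at h1
    linarith
  set r : ℕ := ⌊δ * n⌋₊ with hr
  have hrle : (r : ℝ) ≤ δ * n := Nat.floor_le (by positivity)
  have hrge : δ * n / 2 ≤ r := by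
    have := Nat.lt_floor_add_one (δ * n)
    rw [← hr] at this
    linarith
  have hr1 : (1 : ℝ) ≤ r := by linarith
  have hr0 : 0 < r := by exact_mod_cast (by linarith : (0 : ℝ) < r)
  have hE : (Fintype.card T.edgeSet : ℝ) + 1 = n := by
    have h1 := hT.card_edgeFinset
    rw [hV, SimpleGraph.edgeFinset_card] at h1
    exact_mod_cast h1
  have hN : (n : ℝ) / 2 ≤ Fintype.card T.edgeSet := by linarith
  have hd : ∀ v, T.degree v ≤ d := fun v => (hk v).trans (Nat.le_succ k)
  have hq : (6 * d * r : ℝ) ≤ Fintype.card T.edgeSet := by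
    have h1 : 6 * d * (r : ℝ) ≤ 6 * d * (δ * n) := by gcongr
    nlinarith
  obtain ⟨e₀⟩ : Nonempty T.edgeSet := by
    rw [← Fintype.card_pos_iff]
    exact_mod_cast (by linarith : (0 : ℝ) < Fintype.card T.edgeSet)
  have hL : Fintype.card L = n := (Fintype.card_congr M₀).trans hV
  have ht0 : 0 ≤ t := le_trans (by positivity) ht
  have h3r : 3 * r ≤ ⌊t / c⌋₊ := by
    refine Nat.le_floor ?_
    rw [le_div_iff₀ hc0]
    push_cast
    nlinarith
  obtain ⟨i, hi⟩ := Nat.exists_eq_add_of_le' h3r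
  have hp : ⌊t⌋₊ ≤ ⌊i * c⌋₊ + r * C := by
    have h1 : t < (i + 3 * r + 1) * c := by
      rw [← div_lt_iff₀ hc0]
      have := Nat.lt_floor_add_one (t / c)
      rw [hi] at this
      push_cast at this
      linarith
    have h2 := Nat.lt_floor_add_one (i * c)
    have h3 : 4 * c + 1 ≤ C := Nat.le_ceil _
    have h4 : (r : ℝ) * (4 * c + 1) ≤ r * C := by gcongr
    have h5 := Nat.floor_le ht0
    have h6 : (⌊t⌋₊ : ℝ) ≤ (⌊i * c⌋₊ + r * C : ℕ) := by
      push_cast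
      nlinarith
    exact_mod_cast h6
  have hbad := measureReal_le_of_card_le (i := i) (m := 3 * r) hξ hR hind e₀
    (fun g => {s | (distAt hT c A s M₀ H₀ g t : ℝ) < δ / (4 * lam) * n})
    (fun g => measurableSet_distAt_lt hT c A M₀ H₀ g t _)
    (fun g g' hgg => by
      ext s
      simp only [Set.mem_ofPred_eq]
      rw [distAt_congr hT hc0 A s M₀ H₀ ht0 (by rwa [hi])])
    fun s a => card_distAt_lt_le hT hc0 A s M₀ H₀ hd (Nat.succ_le_succ k.zero_le) hr0 hq e₀
      hi.symm hp a hlam0.le (by rw [hdexp]; linarith)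
  have hbound := hbad.trans (failure_bound hN (by linarith) (by linarith) hB1 (Real.exp_pos _).le
    (by positivity) hr0 hrle le_rfl hA₀)
  have hfinal : P.real {ω | ¬ δ / (4 * lam) * n ≤
      (distAt hT c A (R ω) M₀ H₀ (fun j => ξ j ω) t : ℝ)} ≤ Real.exp (-δ * n) := by
    simp only [not_le]
    refine hbound.trans ?_
    rw [hAδ, hdexp, hL, ← Real.exp_nat_mul, ← Real.exp_nat_mul, ← Real.exp_add, ← Real.exp_add]
    refine Real.exp_le_exp.2 ?_
    have : lam * (δ / (4 * lam) * n) = δ * n / 4 := by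
      field_simp
    rw [this]
    -- The exponent is `-3 * r + δ * n / 4 + δ * n / 4`, and `r ≥ δ * n / 2`.
    nlinarith
  -- Subadditivity replaces the complement rule, so measurability of the event is not needed.
  have hone : (1 : ℝ) ≤ P.real {ω | δ / (4 * lam) * n ≤
      (distAt hT c A (R ω) M₀ H₀ (fun j => ξ j ω) t : ℝ)} + P.real {ω | ¬ δ / (4 * lam) * n ≤
      (distAt hT c A (R ω) M₀ H₀ (fun j => ξ j ω) t : ℝ)} := by
    refine le_trans ?_ (measureReal_union_le _ _)
    rw [← probReal_univ (μ := P)]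
    exact measureReal_mono fun ω _ => em _
  linarith
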